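/- Let $(W,S)$ be a finite Coxeter system with $S=\{s_1,\dots,s_r\}$ and Coxeter length $\ell$. For $w\in W$ let $d(w)=\#\{j\mid \ell(s_jw)<\ell(w)\}$ be its number of left descents. For $I\subseteq\{1,\dots,r\}$ let $W_I=\langle s_i\mid i\in I\rangle$ and let $w_0(W_I)$ be the longest element of $W_I$; for an integer $0\le x\le r$ put $$\mathsf{maxw}_0(W,x)=\max\{\ell(w_0(W_I)) \mid I\subseteq\{1,\dots,r\},\ |I|=x\}.$$ Call $w\in W$ proper if $\ell(w)\le r+\mathsf{maxw}_0(W,d(w))$. Proposition. The number of proper elements in the Coxeter group of type $A_{n-1}$ (that is, $S_n$ with its $r=n-1$ adjacent transpositions as the generating set) is at most $n!\cdot e^{-\Omega(n)}$. That is, there are constants $c>0$ and $N$ such that, for all $n\ge N$, the Coxeter group of type $A_{n-1}$ has at most $n!\,e^{-cn}$ proper elements. -/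

import Mathlib

namespace CoxeterSystem

variable {B : Type*} {M : CoxeterMatrix B} {W : Type*} [Group W]

/-- The standard parabolic subgroup `W_I` of `W`, generated by the simple reflections `s_i` with
`i ∈ I`. -/
def parabolic (cs : CoxeterSystem M W) (I : Set B) : Subgroup W :=
  Subgroup.closure (cs.simple '' I)

/-- `ℓ(w₀(W_I))`, the length of the longest element of the parabolic subgroup `W_I`, that is, the
maximum of the Coxeter length over `W_I`. It is used for finite `W`, where the supremum is
taken over a finite nonempty set of natural numbers and is therefore a maximum. -/
noncomputable def longestLength (cs : CoxeterSystem M W) (I : Set B) : ℕ :=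
  sSup (cs.length '' (cs.parabolic I : Set W))

/-- `d(w) = |J(w)|`, the number of left descents of `w`, that is, of indices `j` such that
`ℓ(s_j w) < ℓ(w)`. -/
noncomputable def leftDescentCount (cs : CoxeterSystem M W) (w : W) : ℕ :=
  {j : B | cs.IsLeftDescent w j}.ncard

/-- `maxw₀(W, x)`, the maximum of `ℓ(w₀(W_I))` over all sets `I` of exactly `x` indices. (Such sets
exist whenever `x` is at most the rank.) -/
noncomputable def maxLongestLength [Fintype B] (cs : CoxeterSystem M W) (x : ℕ) : ℕ :=
  (Finset.powersetCard x (Finset.univ : Finset B)).sup fun I => cs.longestLength (I : Set B)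

/-- An element `w` is *proper* if `ℓ(w) ≤ r + maxw₀(W, d(w))`, where `r` is the rank of the Coxeter
system, i.e. the number of simple reflections. -/
def IsProper [Fintype B] (cs : CoxeterSystem M W) (w : W) : Prop :=
  cs.length w ≤ Fintype.card B + cs.maxLongestLength (cs.leftDescentCount w)

end CoxeterSystem

/-! In type A the group is the symmetric group on `n = m + 1` letters, length is the number of
inversions, and left descents of `w` are descents of the permutation of `w⁻¹`. Since `W_I` has
longest length at most `(#I + 1).choose 2`, a proper element gives a permutation with `d` descents
and at most `m + d(d+1)/2` inversions. A typical permutation has about `n/2` descents and `n²/4`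
inversions. Cut at `d = 2m/3`: either there are at least that many descents
(`card_descentCount_ge_le`), or at most about `2n²/9 < n²/4` inversions
(`card_invCount_le_quadratic_le`). Exponential moments show that both are exponentially rare. -/

open Equiv Finset

/-! ### Inversions and descents under adjacent transpositions -/

/-- The adjacent transposition exchanging `i` and `i + 1`. -/
def adjSwap {m : ℕ} (i : Fin m) : Perm (Fin (m + 1)) := swap i.castSucc i.succ

/-- The set of inversions of a permutation. -/
def inversions {n : ℕ} (σ : Perm (Fin n)) : Finset (Fin n × Fin n) :=
  univ.filter fun p => p.1 < p.2 ∧ σ p.2 < σ p.1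

/-- The number of inversions of a permutation. -/
def invCount {n : ℕ} (σ : Perm (Fin n)) : ℕ := #(inversions σ)

/-- `i` is a descent of `σ` if `σ (i + 1) < σ i`. -/
abbrev IsDescent {m : ℕ} (σ : Perm (Fin (m + 1))) (i : Fin m) : Prop := σ i.succ < σ i.castSucc

theorem adjSwap_mul_self {m : ℕ} (i : Fin m) : adjSwap i * adjSwap i = 1 := swap_mul_self _ _

theorem adjSwap_castSucc {m : ℕ} (i : Fin m) : adjSwap i i.castSucc = i.succ := swap_apply_left _ _

theorem adjSwap_succ {m : ℕ} (i : Fin m) : adjSwap i i.succ = i.castSucc := swap_apply_right _ _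

theorem adjSwap_adjSwap {m : ℕ} (i : Fin m) (a : Fin (m + 1)) : adjSwap i (adjSwap i a) = a := by
  simp [adjSwap]

theorem adjSwap_val {m : ℕ} (i : Fin m) (a : Fin (m + 1)) :
    (adjSwap i a : ℕ) = if (a : ℕ) = i then (i : ℕ) + 1 else if (a : ℕ) = i + 1 then (i : ℕ) else a := by
  simp only [adjSwap, swap_apply_def, Fin.ext_iff, Fin.val_castSucc, Fin.val_succ]
  split_ifs <;> simp

theorem adjSwap_of_ne {m : ℕ} (i : Fin m) (a : Fin (m + 1)) (h : (a : ℕ) ≠ i) (h' : (a : ℕ) ≠ i + 1) :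
    adjSwap i a = a := by
  apply Fin.ext; rw [adjSwap_val, if_neg h, if_neg h']

theorem adjSwap_lt_adjSwap {m : ℕ} (i : Fin m) {a b : Fin (m + 1)} (hab : a < b)
    (h : (a, b) ≠ (i.castSucc, i.succ)) : adjSwap i a < adjSwap i b := by
  rw [Fin.lt_def] at *
  simp only [adjSwap_val]
  simp only [ne_eq, Prod.mk.injEq, Fin.ext_iff, Fin.val_castSucc, Fin.val_succ] at h
  split_ifs <;> omega

theorem mem_inversions {n : ℕ} {σ : Perm (Fin n)} {p : Fin n × Fin n} :
    p ∈ inversions σ ↔ p.1 < p.2 ∧ σ p.2 < σ p.1 := by simp [inversions]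

/-- Applying `adjSwap i` to both coordinates keeps the order of every pair except `(i, i + 1)`, so
it matches the remaining inversions. -/
theorem card_inversions_mul_adjSwap_erase {m : ℕ} (σ : Perm (Fin (m + 1))) (i : Fin m) :
    #((inversions (σ * adjSwap i)).erase (i.castSucc, i.succ)) =
      #((inversions σ).erase (i.castSucc, i.succ)) := by
  have key : ∀ {a b : Fin (m + 1)}, a < b → (a, b) ≠ (i.castSucc, i.succ) →
      (adjSwap i a, adjSwap i b) ≠ (i.castSucc, i.succ) := by
    intro a b hab _ h
    simp only [Prod.mk.injEq] at h
    have h1 := congrArg (adjSwap i) h.1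
    have h2 := congrArg (adjSwap i) h.2
    rw [adjSwap_adjSwap, adjSwap_castSucc] at h1
    rw [adjSwap_adjSwap, adjSwap_succ] at h2
    rw [h1, h2] at hab
    exact absurd hab (not_lt.2 (Fin.castSucc_lt_succ (i := i)).le)
  refine card_bij' (fun p _ => (adjSwap i p.1, adjSwap i p.2))
    (fun p _ => (adjSwap i p.1, adjSwap i p.2)) ?_ ?_ ?_ ?_
  · rintro ⟨a, b⟩ h
    rw [mem_erase, mem_inversions] at h ⊢
    exact ⟨key h.2.1 h.1, adjSwap_lt_adjSwap i h.2.1 h.1, by simpa using h.2.2⟩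
  · rintro ⟨a, b⟩ h
    rw [mem_erase, mem_inversions] at h ⊢
    exact ⟨key h.2.1 h.1, adjSwap_lt_adjSwap i h.2.1 h.1, by simpa [adjSwap_adjSwap] using h.2.2⟩
  · rintro ⟨a, b⟩ _; simp [adjSwap_adjSwap]
  · rintro ⟨a, b⟩ _; simp [adjSwap_adjSwap]

theorem isDescent_mul_adjSwap_self {m : ℕ} (σ : Perm (Fin (m + 1))) (i : Fin m) :
    IsDescent (σ * adjSwap i) i ↔ ¬ IsDescent σ i := by
  have : σ i.castSucc ≠ σ i.succ := fun h => (Fin.castSucc_lt_succ (i := i)).ne (σ.injective h)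
  simp only [IsDescent, Perm.mul_apply, adjSwap_succ, adjSwap_castSucc, not_lt]
  exact ⟨le_of_lt, fun h => lt_of_le_of_ne h this⟩

theorem isDescent_mul_adjSwap_of_not_adjacent {m : ℕ} (σ : Perm (Fin (m + 1))) {i j : Fin m}
    (h : i ≠ j) (h1 : (i : ℕ) + 1 ≠ j) (h2 : (j : ℕ) + 1 ≠ i) :
    IsDescent (σ * adjSwap i) j ↔ IsDescent σ j := by
  have h : (i : ℕ) ≠ j := fun e => h (Fin.ext e)
  simp only [IsDescent, Perm.mul_apply]
  rw [adjSwap_of_ne, adjSwap_of_ne] <;> simp <;> omega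

theorem mem_inversions_adjacent {m : ℕ} (σ : Perm (Fin (m + 1))) (i : Fin m) :
    (i.castSucc, i.succ) ∈ inversions σ ↔ IsDescent σ i := by
  simp [mem_inversions, IsDescent]

theorem invCount_mul_adjSwap_of_not_isDescent {m : ℕ} {σ : Perm (Fin (m + 1))} {i : Fin m}
    (h : ¬ IsDescent σ i) : invCount (σ * adjSwap i) = invCount σ + 1 := by
  have h1 : (i.castSucc, i.succ) ∈ inversions (σ * adjSwap i) :=
    (mem_inversions_adjacent _ _).2 ((isDescent_mul_adjSwap_self σ i).2 h)
  have h2 : (i.castSucc, i.succ) ∉ inversions σ := fun h' => h ((mem_inversions_adjacent _ _).1 h')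
  rw [invCount, ← card_erase_add_one h1, card_inversions_mul_adjSwap_erase, erase_eq_of_notMem h2,
    invCount]

theorem invCount_mul_adjSwap_of_isDescent {m : ℕ} {σ : Perm (Fin (m + 1))} {i : Fin m}
    (h : IsDescent σ i) : invCount (σ * adjSwap i) + 1 = invCount σ := by
  have h' : ¬ IsDescent (σ * adjSwap i) i := fun h' => (isDescent_mul_adjSwap_self σ i).1 h' h
  rw [← invCount_mul_adjSwap_of_not_isDescent h', mul_assoc, adjSwap_mul_self, mul_one]

theorem invCount_mul_adjSwap_le {m : ℕ} (σ : Perm (Fin (m + 1))) (i : Fin m) :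
    invCount (σ * adjSwap i) ≤ invCount σ + 1 := by
  by_cases h : IsDescent σ i
  · have := invCount_mul_adjSwap_of_isDescent h; omega
  · exact (invCount_mul_adjSwap_of_not_isDescent h).le

theorem invCount_one {n : ℕ} : invCount (1 : Perm (Fin n)) = 0 := by
  rw [invCount, card_eq_zero]
  exact eq_empty_of_forall_notMem fun p h =>
    lt_asymm (mem_inversions.1 h).1 (mem_inversions.1 h).2

theorem eq_one_of_forall_not_isDescent {m : ℕ} {σ : Perm (Fin (m + 1))}
    (h : ∀ i, ¬ IsDescent σ i) : σ = 1 := by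
  have hm : StrictMono σ := by
    rw [Fin.strictMono_iff_lt_succ]
    intro i
    exact lt_of_le_of_ne (not_lt.1 (h i))
      fun h => (Fin.castSucc_lt_succ (i := i)).ne (σ.injective h)
  ext a
  have : (hm.orderIsoOfSurjective σ σ.surjective) = OrderIso.refl _ := Subsingleton.elim _ _
  have h2 := congrArg (fun f : Fin (m + 1) ≃o Fin (m + 1) => f a) this
  simpa using congrArg Fin.val h2

/-! ### Order of a group satisfying the type A relations -/

section Coset

variable {G : Type*} [Group G]

/-- The descending product `s m * s (m - 1) * ⋯` with `k` factors. -/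
def descProd (s : ℕ → G) (m : ℕ) : ℕ → G
  | 0 => 1
  | k + 1 => descProd s m k * s (m - k)

variable {s : ℕ → G} {M : ℕ}

theorem descProd_mul_comm (hcomm : ∀ i j, i + 1 < j → j < M → s i * s j = s j * s i)
    {m i : ℕ} (hm : m < M) (k : ℕ) (hi : i + k < m) :
    descProd s m k * s i = s i * descProd s m k := by
  induction k with
  | zero => simp [descProd]
  | succ k ih =>
    rw [descProd, mul_assoc, ← hcomm i (m - k) (by omega) (by omega), ← mul_assoc,
      ih (by omega), mul_assoc]

/-- `s (i + 1)` commutes leftwards until it meets `s (i + 1) * s i`; the braid relation then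
releases an `s i`, which commutes with all earlier factors. -/
theorem descProd_mul_braid (hcomm : ∀ i j, i + 1 < j → j < M → s i * s j = s j * s i)
    (hbraid : ∀ i, i + 1 < M → s i * s (i + 1) * s i = s (i + 1) * s i * s (i + 1))
    {m : ℕ} (hm : m < M) {i : ℕ} (him : i + 1 ≤ m) (k : ℕ) (hk : k ≤ m + 1) (hi : m < i + k) :
    descProd s m k * s (i + 1) = s i * descProd s m k := by
  induction k with
  | zero => omega
  | succ k ih =>
    by_cases h : m < i + k
    · rw [descProd, mul_assoc, hcomm (m - k) (i + 1) (by omega) (by omega), ← mul_assoc,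
        ih (by omega) h, mul_assoc]
    · obtain rfl : m = i + k := by omega
      obtain ⟨k, rfl⟩ : ∃ l, k = l + 1 := ⟨k - 1, by omega⟩
      rw [descProd, descProd, show i + (k + 1) - k = i + 1 by omega,
        show i + (k + 1) - (k + 1) = i by omega, mul_assoc, mul_assoc, ← mul_assoc (s (i + 1)),
        ← hbraid i (by omega), mul_assoc (s i), ← mul_assoc, descProd_mul_comm hcomm hm k (by omega),
        mul_assoc, mul_assoc]

/-- A group generated by `m` involutions satisfying the relations of type `A` has at most
`(m + 1)!` elements. -/
theorem finite_closure_and_card_le (hsq : ∀ i, i < M → s i * s i = 1)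
    (hcomm : ∀ i j, i + 1 < j → j < M → s i * s j = s j * s i)
    (hbraid : ∀ i, i + 1 < M → s i * s (i + 1) * s i = s (i + 1) * s i * s (i + 1))
    (m : ℕ) (hm : m ≤ M) :
    (Subgroup.closure (s '' Set.Iio m) : Set G).Finite ∧
      (Subgroup.closure (s '' Set.Iio m) : Set G).ncard ≤ (m + 1).factorial := by
  induction m with
  | zero => simp
  | succ m ih =>
    obtain ⟨hfin, hcard⟩ := ih (by omega)
    set H := Subgroup.closure (s '' Set.Iio m) with hH
    have hsH : ∀ i, i < m → s i ∈ H := fun i hi => Subgroup.subset_closure ⟨i, hi, rfl⟩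
    -- `T` is a union of `m + 2` cosets of `H`. It is stable under right multiplication by `s i`:
    -- the factor passes through, lengthens the product, cancels its last letter, or passes through
    -- as `s (i - 1)`, according as `i + k` is below `m`, `m`, `m + 1` or larger.
    let T : Set G := Set.image2 (· * ·) (H : Set G) (descProd s m '' Set.Iic (m + 1))
    have hT : ∀ g ∈ T, ∀ i, i < m + 1 → g * s i ∈ T := by
      rintro _ ⟨h, hh, _, ⟨k, hk, rfl⟩, rfl⟩ i hi
      simp only [Set.mem_Iic] at hk
      rcases lt_trichotomy (i + k) m with h1 | h1 | h1
      · refine ⟨h * s i, H.mul_mem hh (hsH i (by omega)), _, ⟨k, hk, rfl⟩, ?_⟩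
        simp only [mul_assoc]
        rw [descProd_mul_comm hcomm (by omega) k (by omega)]
      · refine ⟨h, hh, _, ⟨k + 1, Set.mem_Iic.2 (by omega), rfl⟩, ?_⟩
        simp only [mul_assoc, descProd]
        rw [show m - k = i by omega]
      · by_cases h2 : i + k = m + 1
        · obtain ⟨k, rfl⟩ : ∃ l, k = l + 1 := ⟨k - 1, by omega⟩
          refine ⟨h, hh, _, ⟨k, Set.mem_Iic.2 (by omega), rfl⟩, ?_⟩
          simp only [mul_assoc, descProd]
          rw [show m - k = i by omega, hsq i (by omega), mul_one]
        · obtain ⟨i, rfl⟩ : ∃ l, i = l + 1 := ⟨i - 1, by omega⟩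
          refine ⟨h * s i, H.mul_mem hh (hsH i (by omega)), _, ⟨k, hk, rfl⟩, ?_⟩
          simp only [mul_assoc]
          rw [descProd_mul_braid hcomm hbraid (by omega) (by omega) k hk (by omega)]
    have hsub : (Subgroup.closure (s '' Set.Iio (m + 1)) : Set G) ⊆ T := by
      intro g hg
      induction hg using Subgroup.closure_induction_right with
      | one => exact ⟨1, H.one_mem, 1, ⟨0, by simp, rfl⟩, one_mul 1⟩
      | mul_right x hx y hy ih =>
        obtain ⟨i, hi, rfl⟩ := hy
        exact hT x ih i hi
      | mul_inv_cancel x hx y hy ih =>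
        obtain ⟨i, hi, rfl⟩ := hy
        rw [inv_eq_of_mul_eq_one_left (hsq i (lt_of_lt_of_le hi hm))]
        exact hT x ih i hi
    have hCfin : (descProd s m '' Set.Iic (m + 1)).Finite := (Set.finite_Iic _).image _
    have hTfin : T.Finite := hfin.image2 _ hCfin
    refine ⟨hTfin.subset hsub, (Set.ncard_le_ncard hsub hTfin).trans ?_⟩
    have hC : (descProd s m '' Set.Iic (m + 1)).ncard ≤ m + 2 := by
      refine (Set.ncard_image_le (Set.finite_Iic _)).trans ?_
      rw [← Nat.card_coe_set_eq]; simp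
    calc T.ncard ≤ (H : Set G).ncard * (descProd s m '' Set.Iic (m + 1)).ncard := by
          simp only [← Nat.card_coe_set_eq]
          exact Set.natCard_mul_le
      _ ≤ (m + 1).factorial * (m + 2) := Nat.mul_le_mul hcard hC
      _ = (m + 1 + 1).factorial := by rw [Nat.factorial_succ (m + 1)]; ring

end Coset

/-! ### The type A Coxeter group as a symmetric group -/

theorem CoxeterMatrix.A_apply {m : ℕ} (i j : Fin m) :
    CoxeterMatrix.A m i j =
      if i = j then 1 else if (j : ℕ) + 1 = i ∨ (i : ℕ) + 1 = j then 3 else 2 := rfl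

theorem adjSwap_mul_comm {m : ℕ} {i j : Fin m} (h : i ≠ j) (h1 : (i : ℕ) + 1 ≠ j)
    (h2 : (j : ℕ) + 1 ≠ i) : adjSwap i * adjSwap j = adjSwap j * adjSwap i := by
  have h : (i : ℕ) ≠ j := fun e => h (Fin.ext e)
  ext a
  simp only [Perm.mul_apply, adjSwap_val]
  split_ifs <;> omega

theorem adjSwap_braid {m : ℕ} {i j : Fin m} (h1 : (i : ℕ) + 1 = j) :
    adjSwap i * adjSwap j * adjSwap i = adjSwap j * adjSwap i * adjSwap j := by
  have e : j.castSucc = i.succ := Fin.ext (by simp [h1])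
  have hlt : i.castSucc < i.succ := Fin.castSucc_lt_succ
  have hlt' : i.succ < j.succ := e ▸ Fin.castSucc_lt_succ
  simp only [adjSwap, e]
  rw [swap_mul_swap_mul_swap hlt.ne (hlt.trans hlt').ne, swap_comm i.castSucc i.succ,
    swap_comm i.succ j.succ, swap_mul_swap_mul_swap hlt'.ne' (hlt.trans hlt').ne', swap_comm]

theorem mul_pow_three_eq_one {G : Type*} [Group G] {a b : G} (ha : a * a = 1) (hb : b * b = 1) :
    (a * b) ^ 3 = 1 ↔ a * b * a = b * a * b := by
  have h : (a * b) ^ 3 = (a * b * a) * (b * a * b) := by simp only [pow_succ, pow_zero, one_mul, mul_assoc]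
  have h' : (b * a * b) * (b * a * b) = 1 := by
    rw [show b * a * b * (b * a * b) = b * (a * (b * b) * a) * b by simp only [mul_assoc], hb, mul_one,
      ha, mul_one, hb]
  rw [h]
  constructor
  · intro h; exact mul_right_cancel (h.trans h'.symm)
  · intro h; rw [h, h']

theorem mul_pow_two_eq_one {G : Type*} [Group G] {a b : G} (ha : a * a = 1) (hb : b * b = 1) :
    (a * b) ^ 2 = 1 ↔ a * b = b * a := by
  have h' : (b * a) * (a * b) = 1 := by
    rw [mul_assoc, ← mul_assoc a, ha, one_mul, hb]
  rw [pow_two]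
  constructor
  · intro h; exact mul_right_cancel (h.trans h'.symm)
  · intro h; nth_rw 1 [h]; exact h'

theorem isLiftable_adjSwap (m : ℕ) :
    (CoxeterMatrix.A m).IsLiftable (fun i : Fin m => adjSwap i) := by
  intro i j
  rw [CoxeterMatrix.A_apply]
  split_ifs with h h'
  · rw [h, pow_one, adjSwap_mul_self]
  · rw [mul_pow_three_eq_one (adjSwap_mul_self i) (adjSwap_mul_self j)]
    rcases h' with h' | h'
    · exact (adjSwap_braid h').symm
    · exact adjSwap_braid h'
  · rw [mul_pow_two_eq_one (adjSwap_mul_self i) (adjSwap_mul_self j)]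
    exact adjSwap_mul_comm h (fun e => h' (Or.inr e)) (fun e => h' (Or.inl e))

namespace CoxeterSystem

variable {m : ℕ} {W : Type*} [Group W] (cs : CoxeterSystem (CoxeterMatrix.A m) W)

/-- The homomorphism from a Coxeter group of type `A` to the symmetric group. -/
noncomputable def toPerm : W →* Perm (Fin (m + 1)) := cs.lift ⟨_, isLiftable_adjSwap m⟩

theorem toPerm_simple (i : Fin m) : cs.toPerm (cs.simple i) = adjSwap i :=
  cs.lift_apply_simple (isLiftable_adjSwap m) i

theorem toPerm_surjective : Function.Surjective cs.toPerm := by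
  rw [← MonoidHom.mrange_eq_top, eq_top_iff, ← Perm.mclosure_swap_castSucc_succ m,
    Submonoid.closure_le]
  rintro _ ⟨i, rfl⟩
  exact ⟨cs.simple i, cs.toPerm_simple i⟩

theorem finite_and_card_le_of_typeA {m : ℕ} {W : Type*} [Group W]
    (cs : CoxeterSystem (CoxeterMatrix.A m) W) : Finite W ∧ Nat.card W ≤ (m + 1).factorial := by
  let s : ℕ → W := fun i => if h : i < m then cs.simple ⟨i, h⟩ else 1
  have hs : ∀ i (h : i < m), s i = cs.simple ⟨i, h⟩ := fun i h => dif_pos h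
  have hpow : ∀ i j (hi : i < m) (hj : j < m),
      (s i * s j) ^ (CoxeterMatrix.A m ⟨i, hi⟩ ⟨j, hj⟩) = 1 := by
    intro i j hi hj
    rw [hs i hi, hs j hj, cs.simple_mul_simple_pow]
  have hsq : ∀ i, i < m → s i * s i = 1 := fun i hi => by
    rw [hs i hi, cs.simple_mul_simple_self]
  obtain ⟨h1, h2⟩ := finite_closure_and_card_le (s := s) (M := m) hsq
    (fun i j hij hj => by
      have := hpow i j (by omega) hj
      rwa [CoxeterMatrix.A_apply, if_neg (by simp; omega), if_neg (by simp; omega),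
        mul_pow_two_eq_one (hsq _ (by omega)) (hsq _ hj)] at this)
    (fun i hi => by
      have := hpow i (i + 1) (by omega) hi
      rwa [CoxeterMatrix.A_apply, if_neg (by simp), if_pos (by simp),
        mul_pow_three_eq_one (hsq _ (by omega)) (hsq _ hi)] at this) m le_rfl
  have htop : Subgroup.closure (s '' Set.Iio m) = ⊤ := by
    rw [← cs.subgroup_closure_range_simple]
    congr 1
    ext g
    constructor
    · rintro ⟨i, hi, rfl⟩; exact ⟨⟨i, hi⟩, (hs i hi).symm⟩
    · rintro ⟨i, rfl⟩; exact ⟨i, i.2, hs i i.2⟩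
  rw [htop, Subgroup.coe_top] at h1 h2
  rw [Set.ncard_univ] at h2
  exact ⟨Set.finite_univ_iff.1 h1, h2⟩

/-- A surjection onto `(m + 1)!` elements from at most that many is a bijection. -/
theorem toPerm_injective : Function.Injective cs.toPerm := by
  obtain ⟨_, h⟩ := cs.finite_and_card_le_of_typeA
  refine ((Nat.bijective_iff_surjective_and_card _).2 ⟨cs.toPerm_surjective, ?_⟩).1
  refine le_antisymm ?_ (Nat.card_le_card_of_surjective _ cs.toPerm_surjective)
  simpa [Fintype.card_perm] using h

theorem invCount_toPerm_le_length (w : W) : invCount (cs.toPerm w) ≤ cs.length w := by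
  obtain ⟨ω, hω, rfl⟩ := cs.exists_isReduced w
  rw [hω.eq]
  clear hω
  induction ω using List.reverseRecOn with
  | nil => simp [invCount_one]
  | append_singleton ω i ih =>
    rw [cs.wordProd_append, cs.wordProd_singleton, map_mul, cs.toPerm_simple, List.length_append]
    exact (invCount_mul_adjSwap_le _ _).trans (Nat.add_le_add_right ih 1)

/-- Right multiplication at a descent removes one inversion, so `invCount` such steps reach the
identity. -/
theorem length_eq_invCount (w : W) : cs.length w = invCount (cs.toPerm w) := by
  refine le_antisymm ?_ (cs.invCount_toPerm_le_length w)
  induction h : invCount (cs.toPerm w) generalizing w with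
  | zero =>
    have : cs.toPerm w = 1 := eq_one_of_forall_not_isDescent fun i hi => by
      have := invCount_mul_adjSwap_of_isDescent hi
      omega
    have hw : w = 1 := cs.toPerm_injective (this.trans (map_one cs.toPerm).symm)
    rw [hw, cs.length_one]
  | succ k ih =>
    obtain ⟨i, hi⟩ : ∃ i, IsDescent (cs.toPerm w) i := by
      by_contra hne
      rw [eq_one_of_forall_not_isDescent (not_exists.1 hne), invCount_one] at h
      omega
    have h2 := invCount_mul_adjSwap_of_isDescent hi
    rw [← cs.toPerm_simple, ← map_mul] at h2
    have h3 := ih (w * cs.simple i) (by omega)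
    rcases cs.length_mul_simple w i with h4 | h4 <;> omega

theorem isRightDescent_iff_isDescent (w : W) (i : Fin m) :
    cs.IsRightDescent w i ↔ IsDescent (cs.toPerm w) i := by
  rw [IsRightDescent, cs.length_eq_invCount, cs.length_eq_invCount, map_mul, cs.toPerm_simple]
  by_cases h : IsDescent (cs.toPerm w) i
  · have := invCount_mul_adjSwap_of_isDescent h
    exact iff_of_true (by omega) h
  · have := invCount_mul_adjSwap_of_not_isDescent h
    exact iff_of_false (by omega) h

theorem leftDescentCount_eq (w : W) :
    cs.leftDescentCount w = #{i : Fin m | IsDescent (cs.toPerm w⁻¹) i} := by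
  rw [leftDescentCount, ← Set.ncard_coe_finset]
  congr 1
  ext i
  rw [Set.mem_ofPred_eq, ← inv_inv w, cs.isLeftDescent_inv_iff, cs.isRightDescent_iff_isDescent]
  simp

/-! ### Lengths in parabolic subgroups -/

theorem toPerm_le_iff_of_mem_parabolic {I : Set (Fin m)} {w : W} (hw : w ∈ cs.parabolic I)
    {i : Fin m} (hi : i ∉ I) (a : Fin (m + 1)) :
    cs.toPerm w a ≤ i.castSucc ↔ a ≤ i.castSucc := by
  induction hw using Subgroup.closure_induction generalizing a with
  | mem x hx =>
    obtain ⟨j, hj, rfl⟩ := hx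
    have hij : (i : ℕ) ≠ j := fun e => hi (by rwa [Fin.ext e])
    rw [cs.toPerm_simple, Fin.le_def, Fin.le_def, adjSwap_val, Fin.val_castSucc]
    split_ifs <;> omega
  | one => simp
  | mul x y _ _ hx hy => rw [map_mul, Perm.mul_apply, hx, hy]
  | inv x _ hx => rw [← hx, map_inv]; simp

theorem mem_of_mem_inversions_toPerm {I : Set (Fin m)} {w : W} (hw : w ∈ cs.parabolic I)
    {a b : Fin (m + 1)} (h : (a, b) ∈ inversions (cs.toPerm w)) {i : Fin m}
    (ha : a ≤ i.castSucc) (hb : i.castSucc < b) : i ∈ I := by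
  by_contra hi
  have h1 := (cs.toPerm_le_iff_of_mem_parabolic hw hi a).2 ha
  have h2 := (cs.toPerm_le_iff_of_mem_parabolic hw hi b).not.2 (not_le.2 hb)
  exact h2 (((mem_inversions.1 h).2.le).trans h1)

/-- No inversion `(a, b)` straddles a cut outside `I`, so `a` and `b - 1` lie in `I`. Unordered
pairs from `I`, repetition allowed, therefore bound the inversions. -/
theorem length_le_of_mem_parabolic {I : Finset (Fin m)} {w : W}
    (hw : w ∈ cs.parabolic (I : Set (Fin m))) : cs.length w ≤ (#I + 1).choose 2 := by
  rw [cs.length_eq_invCount, invCount, ← card_sym2]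
  rcases Nat.eq_zero_or_pos m with rfl | hm
  · have : inversions (cs.toPerm w) = ∅ := by
      ext p
      simp only [mem_inversions, Fin.lt_def, notMem_empty, iff_false]
      omega
    simp [this]
  have key : ∀ {a b : Fin (m + 1)}, (a, b) ∈ inversions (cs.toPerm w) →
      ∀ k : ℕ, (hk : k < m) → (a : ℕ) ≤ k → k < b → (⟨k, hk⟩ : Fin m) ∈ I := by
    intro a b h k hk h1 h2
    exact cs.mem_of_mem_inversions_toPerm hw h (Fin.le_def.2 h1) (Fin.lt_def.2 h2)
  -- The `min` only serves to land in `Fin m`; on an inversion `a < b`, so it changes nothing.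
  let f : Fin (m + 1) → Fin m := fun a => ⟨min a (m - 1), by omega⟩
  let g : Fin (m + 1) → Fin m := fun b => ⟨b - 1, by omega⟩
  refine card_le_card_of_injOn (fun p => s(f p.1, g p.2)) ?_ ?_
  · rintro ⟨a, b⟩ h
    have hab := (mem_inversions.1 h).1
    rw [Fin.lt_def] at hab
    dsimp only at hab
    simp only [mem_coe, mk_mem_sym2_iff]
    exact ⟨key h _ _ (by omega) (by omega), key h _ _ (by omega) (by omega)⟩
  · rintro ⟨a, b⟩ h ⟨a', b'⟩ h' heq
    have hab := (mem_inversions.1 h).1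
    have hab' := (mem_inversions.1 h').1
    rw [Fin.lt_def] at hab hab'
    dsimp only at hab hab'
    simp only [Sym2.eq_iff, f, g, Fin.ext_iff] at heq
    simp only [Prod.mk.injEq, Fin.ext_iff]
    omega

theorem maxLongestLength_le (x : ℕ) : cs.maxLongestLength x ≤ (x + 1).choose 2 := by
  refine Finset.sup_le fun I hI => ?_
  rw [mem_powersetCard_univ] at hI
  refine csSup_le (Set.Nonempty.image _ ⟨1, Subgroup.one_mem _⟩) ?_
  rintro _ ⟨w, hw, rfl⟩
  rw [← hI]
  exact cs.length_le_of_mem_parabolic hw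

end CoxeterSystem

/-! ### Upper tail of the descent number -/

/-- The number of descents of a permutation. -/
def descentCount {m : ℕ} (σ : Perm (Fin (m + 1))) : ℕ := #{i : Fin m | IsDescent σ i}

/-- Descents at pairwise nonadjacent positions are independent and fair: `σ ↦ σ * adjSwap i` flips
the one at `i` and keeps the others. Each position contributes the mean `(1 + 2) / 2`. -/
theorem sum_two_pow_card_descents {m : ℕ} (J : Finset (Fin m))
    (hJ : ∀ i ∈ J, ∀ j ∈ J, (i : ℕ) + 1 ≠ j) :
    ∑ σ : Perm (Fin (m + 1)), (2 : ℝ) ^ #{i ∈ J | IsDescent σ i} =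
      (m + 1).factorial * (3 / 2 : ℝ) ^ #J := by
  induction J using Finset.induction_on with
  | empty => simp [Fintype.card_perm]
  | insert i J hi ih =>
    specialize ih fun a ha b hb => hJ a (mem_insert_of_mem ha) b (mem_insert_of_mem hb)
    let F : Perm (Fin (m + 1)) → ℝ := fun σ => 2 ^ #{j ∈ J | IsDescent σ j}
    let g : Perm (Fin (m + 1)) → ℝ := fun σ => if IsDescent σ i then 2 else 1
    have hF : ∀ σ, F (σ * adjSwap i) = F σ := by
      intro σ
      simp only [F]
      congr 2
      refine filter_congr fun j hj => ?_
      exact isDescent_mul_adjSwap_of_not_adjacent σ (fun h => hi (h ▸ hj))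
        (hJ _ (mem_insert_self _ _) _ (mem_insert_of_mem hj))
        (hJ _ (mem_insert_of_mem hj) _ (mem_insert_self _ _))
    have hg : ∀ σ, g σ + g (σ * adjSwap i) = 3 := by
      intro σ
      simp only [g, isDescent_mul_adjSwap_self]
      by_cases h : IsDescent σ i
      · rw [if_pos h, if_neg (not_not.2 h)]; norm_num
      · rw [if_neg h, if_pos h]; norm_num
    have hsplit : ∀ σ, (2 : ℝ) ^ #{j ∈ insert i J | IsDescent σ j} = g σ * F σ := by
      intro σ
      rw [filter_insert]
      by_cases h : IsDescent σ i
      · rw [if_pos h, card_insert_of_notMem (by simp [hi])]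
        simp only [g, F, if_pos h, pow_succ, mul_comm]
      · simp only [g, F, if_neg h, one_mul]
    have hreindex : ∑ σ, g σ * F σ = ∑ σ, g (σ * adjSwap i) * F σ := by
      rw [← Equiv.sum_comp (Equiv.mulRight (adjSwap i))]
      simp [hF]
    have htwo : 2 * ∑ σ, g σ * F σ = 3 * ∑ σ, F σ := by
      rw [two_mul]
      nth_rw 2 [hreindex]
      rw [← sum_add_distrib, mul_sum]
      exact sum_congr rfl fun σ _ => by rw [← add_mul, hg]
    rw [card_insert_of_notMem hi]
    simp only [hsplit]
    have : ∑ σ, F σ = (m + 1).factorial * (3 / 2 : ℝ) ^ #J := ih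
    rw [pow_succ]
    linarith

theorem card_many_descents_le {m : ℕ} (J : Finset (Fin m))
    (hJ : ∀ i ∈ J, ∀ j ∈ J, (i : ℕ) + 1 ≠ j) (hcard : 2 * #J ≤ m + 1) :
    (#{σ : Perm (Fin (m + 1)) | m ≤ 3 * #{i ∈ J | IsDescent σ i}} : ℝ) ≤
      (m + 1).factorial *
        Real.exp ((m + 1) / 2 * Real.log (3 / 2) - m / 3 * Real.log 2) := by
  have h1 : (#{σ : Perm (Fin (m + 1)) | m ≤ 3 * #{i ∈ J | IsDescent σ i}} : ℝ) *
      Real.exp (m / 3 * Real.log 2) ≤ (m + 1).factorial * (3 / 2 : ℝ) ^ #J := by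
    rw [← sum_two_pow_card_descents J hJ, ← nsmul_eq_mul, ← sum_const]
    refine (sum_le_sum fun σ hσ => ?_).trans
      (sum_le_sum_of_subset_of_nonneg (filter_subset _ _) fun _ _ _ => by positivity)
    rw [mem_filter] at hσ
    rw [← Real.exp_log (show (0 : ℝ) < 2 by norm_num), ← Real.exp_nat_mul, Real.exp_le_exp,
      Real.exp_log (by norm_num)]
    refine mul_le_mul_of_nonneg_right ?_ (Real.log_nonneg (by norm_num))
    have : (m : ℝ) ≤ 3 * #{i ∈ J | IsDescent σ i} := by exact_mod_cast hσ.2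
    linarith
  have h2 : (3 / 2 : ℝ) ^ #J ≤ Real.exp ((m + 1) / 2 * Real.log (3 / 2)) := by
    rw [← Real.exp_log (show (0 : ℝ) < 3 / 2 by norm_num), ← Real.exp_nat_mul, Real.exp_le_exp,
      Real.exp_log (by norm_num)]
    refine mul_le_mul_of_nonneg_right ?_ (Real.log_nonneg (by norm_num))
    have : (2 * #J : ℝ) ≤ m + 1 := by exact_mod_cast hcard
    linarith
  rw [Real.exp_sub, ← mul_div_assoc, le_div_iff₀ (Real.exp_pos _)]
  exact h1.trans (mul_le_mul_of_nonneg_left h2 (by positivity))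

/-- Even and odd positions each form a nonadjacent set, and one of them carries at least half of the
descents. -/
theorem card_descentCount_ge_le (m : ℕ) :
    (#{σ : Perm (Fin (m + 1)) | 2 * m ≤ 3 * descentCount σ} : ℝ) ≤
      2 * ((m + 1).factorial *
        Real.exp ((m + 1) / 2 * Real.log (3 / 2) - m / 3 * Real.log 2)) := by
  let J : ℕ → Finset (Fin m) := fun r => {i | (i : ℕ) % 2 = r}
  have hJ : ∀ r, ∀ i ∈ J r, ∀ j ∈ J r, (i : ℕ) + 1 ≠ j := by
    intro r i hi j hj
    simp only [J, mem_filter_univ] at hi hj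
    omega
  have hcard : ∀ r, 2 * #(J r) ≤ m + 1 := by
    intro r
    have : #(J r) ≤ #(range ((m + 1) / 2)) := by
      refine card_le_card_of_injOn (fun i => (i : ℕ) / 2) ?_ ?_
      · intro i _
        simp only [coe_range, Set.mem_Iio]
        omega
      · intro i hi j hj h
        simp only [J, coe_filter, mem_univ, true_and, Set.mem_ofPred_eq] at hi hj
        dsimp only at h
        ext
        omega
    rw [card_range] at this
    omega
  have hsub : ({σ | 2 * m ≤ 3 * descentCount σ} : Finset (Perm (Fin (m + 1)))) ⊆
      (univ.filter fun σ => m ≤ 3 * #{i ∈ J 0 | IsDescent σ i}) ∪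
        univ.filter fun σ => m ≤ 3 * #{i ∈ J 1 | IsDescent σ i} := by
    intro σ hσ
    simp only [mem_union, mem_filter_univ] at hσ ⊢
    have : descentCount σ ≤ #{i ∈ J 0 | IsDescent σ i} + #{i ∈ J 1 | IsDescent σ i} := by
      refine (card_le_card ?_).trans (card_union_le _ _)
      intro i hi
      simp only [J, mem_union, mem_filter, mem_univ, true_and] at hi ⊢
      rcases Nat.mod_two_eq_zero_or_one (i : ℕ) with h | h
      · exact Or.inl ⟨h, hi⟩
      · exact Or.inr ⟨h, hi⟩
    omega
  have h := (card_le_card hsub).trans (card_union_le _ _)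
  have h' : (#{σ : Perm (Fin (m + 1)) | 2 * m ≤ 3 * descentCount σ} : ℝ) ≤
      #{σ : Perm (Fin (m + 1)) | m ≤ 3 * #{i ∈ J 0 | IsDescent σ i}} +
        #{σ : Perm (Fin (m + 1)) | m ≤ 3 * #{i ∈ J 1 | IsDescent σ i}} := by exact_mod_cast h
  have h0 := card_many_descents_le (J 0) (hJ 0) (hcard 0)
  have h1 := card_many_descents_le (J 1) (hJ 1) (hcard 1)
  linarith

/-! ### Lower tail of the inversion number -/

/-- The inversion table of a permutation: the number of larger entries before position `i`. -/
def lehmerCode {n : ℕ} (σ : Perm (Fin n)) (i : Fin n) : ℕ := #{j : Fin n | j < i ∧ σ i < σ j}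

theorem lehmerCode_le {n : ℕ} (σ : Perm (Fin n)) (i : Fin n) : lehmerCode σ i ≤ i := by
  refine (card_le_card (t := Iio i) fun j hj => ?_).trans (by simp)
  simp only [mem_filter_univ] at hj
  exact mem_Iio.2 hj.1

theorem invCount_eq_sum_lehmerCode {n : ℕ} (σ : Perm (Fin n)) :
    invCount σ = ∑ i, lehmerCode σ i := by
  simp only [invCount, inversions, lehmerCode, card_filter]
  rw [Fintype.sum_prod_type_right]

/-- At the last position `i` where two permutations differ, the same values occupy the positions up
to `i`. The code at `i` counts those exceeding the entry at `i`, so the larger entry has the smaller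
code. -/
theorem lehmerCode_injective {n : ℕ} : Function.Injective (lehmerCode (n := n)) := by
  intro σ τ h
  by_contra hne
  have hD : ({i | σ i ≠ τ i} : Finset (Fin n)).Nonempty := by
    by_contra hD
    rw [not_nonempty_iff_eq_empty, filter_eq_empty_iff] at hD
    exact hne (Equiv.ext fun i => not_not.1 (hD (mem_univ i)))
  obtain ⟨i, hi, hmax⟩ := Finset.exists_maximal hD
  simp only [mem_filter_univ] at hi hmax
  have hgt : ∀ j, i < j → σ j = τ j := by
    intro j hj
    by_contra hjne
    exact absurd (hmax hjne hj.le) (not_le.2 hj)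
  have hcode : ∀ ρ : Perm (Fin n), lehmerCode ρ i = #{v : Fin n | ρ.symm v < i ∧ ρ i < v} := by
    intro ρ
    refine card_bij' (fun j _ => ρ j) (fun v _ => ρ.symm v) ?_ ?_ ?_ ?_ <;> simp
  have hle : ∀ v, σ.symm v ≤ i ↔ τ.symm v ≤ i := by
    intro v
    rw [← not_iff_not, not_le, not_le]
    constructor
    · intro hv
      have := hgt _ hv
      rw [apply_symm_apply] at this
      rw [(symm_apply_eq τ).2 this]; exact hv
    · intro hv
      have := hgt _ hv
      rw [apply_symm_apply] at this
      rw [(symm_apply_eq σ).2 this.symm]; exact hv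
  have hcode' : ∀ ρ : Perm (Fin n), lehmerCode ρ i = #{v : Fin n | ρ.symm v ≤ i ∧ ρ i < v} := by
    intro ρ
    rw [hcode]
    congr 1
    refine filter_congr fun v _ => and_congr_left fun hv => ?_
    refine ⟨le_of_lt, fun h => lt_of_le_of_ne h fun e => ?_⟩
    rw [← e, apply_symm_apply] at hv
    exact lt_irrefl _ hv
  have hlt : ∀ ρ ρ' : Perm (Fin n), (∀ v, ρ.symm v ≤ i ↔ ρ'.symm v ≤ i) → ρ i < ρ' i →
      lehmerCode ρ' i < lehmerCode ρ i := by
    intro ρ ρ' hρ hi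
    rw [hcode', hcode']
    refine card_lt_card ((ssubset_iff_of_subset fun v hv => ?_).2 ⟨ρ' i, ?_, ?_⟩)
    · simp only [mem_filter_univ] at hv ⊢
      exact ⟨(hρ v).2 hv.1, hi.trans hv.2⟩
    · simp only [mem_filter_univ]
      exact ⟨(hρ _).2 (by simp), hi⟩
    · simp
  have hii := congrFun h i
  rcases lt_or_gt_of_ne hi with hlt' | hlt'
  · exact absurd hii (hlt σ τ hle hlt').ne'
  · exact absurd hii (hlt τ σ (fun v => (hle v).symm) hlt').ne

/-- The codes lie in the box `∏ {0, …, i}`, over which the sum factors. -/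
theorem sum_pow_invCount_le {n : ℕ} {x : ℝ} (hx : 0 ≤ x) :
    ∑ σ : Perm (Fin n), x ^ invCount σ ≤ ∏ i : Fin n, ∑ j ∈ range (i + 1), x ^ j := by
  rw [prod_univ_sum]
  calc ∑ σ : Perm (Fin n), x ^ invCount σ
      = ∑ c ∈ univ.image (lehmerCode (n := n)), ∏ i, x ^ c i := by
        rw [sum_image (lehmerCode_injective.injOn)]
        exact sum_congr rfl fun σ _ => by rw [invCount_eq_sum_lehmerCode, prod_pow_eq_pow_sum]
    _ ≤ _ := by
        refine sum_le_sum_of_subset_of_nonneg ?_ fun _ _ _ => prod_nonneg fun _ _ => pow_nonneg hx _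
        intro c hc
        obtain ⟨σ, -, rfl⟩ := mem_image.1 hc
        exact Fintype.mem_piFinset.2 fun i => mem_range.2 (Nat.lt_succ_of_le (lehmerCode_le σ i))

theorem exp_neg_le_quadratic {y : ℝ} (hy : 0 ≤ y) : Real.exp (-y) ≤ 1 - y + y ^ 2 / 2 := by
  have h := Real.quadratic_le_exp_of_nonneg hy
  have hpos : 0 < 1 + y + y ^ 2 / 2 := by positivity
  rw [Real.exp_neg]
  refine (inv_anti₀ hpos h).trans ?_
  rw [inv_eq_one_div, div_le_iff₀ hpos]
  -- `(1 + y + y²/2)(1 - y + y²/2) = 1 + y⁴/4`.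
  nlinarith [pow_nonneg hy 4]

theorem sum_exp_neg_le {n k : ℕ} (hk : k < n) {t : ℝ} (ht : 0 ≤ t) :
    ∑ j ∈ range (k + 1), Real.exp (-t) ^ j ≤
      (k + 1) * Real.exp (-(t * k / 2) + t ^ 2 * n ^ 2 / 2) := by
  have h1 : ∀ j ∈ range (k + 1), Real.exp (-t) ^ j ≤ 1 - t * j + t ^ 2 * n ^ 2 / 2 := by
    intro j hj
    have hjn : (j : ℝ) ≤ n := by
      exact_mod_cast (Nat.lt_succ_iff.1 (mem_range.1 hj)).trans hk.le
    have h := exp_neg_le_quadratic (mul_nonneg ht (Nat.cast_nonneg j))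
    rw [← Real.exp_nat_mul, show (j : ℝ) * -t = -(t * j) by ring]
    have : (t * j) ^ 2 ≤ t ^ 2 * n ^ 2 := by rw [mul_pow]; gcongr
    linarith
  have h2 : ∑ j ∈ range (k + 1), (j : ℝ) = k * (k + 1) / 2 := by
    have := Finset.sum_range_id_mul_two (k + 1)
    rw [Nat.add_sub_cancel] at this
    have h3 := congrArg (Nat.cast (R := ℝ)) this
    push_cast at h3
    linarith
  calc ∑ j ∈ range (k + 1), Real.exp (-t) ^ j
      ≤ ∑ j ∈ range (k + 1), (1 - t * j + t ^ 2 * n ^ 2 / 2) := sum_le_sum h1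
    _ = (k + 1) * (-(t * k / 2) + t ^ 2 * n ^ 2 / 2 + 1) := by
        rw [sum_add_distrib, sum_sub_distrib, ← mul_sum, h2]
        simp
        ring
    _ ≤ _ := mul_le_mul_of_nonneg_left (Real.add_one_le_exp _) (by positivity)

theorem card_invCount_le_le {n : ℕ} {t L : ℝ} (ht : 0 ≤ t) :
    (#{σ : Perm (Fin n) | (invCount σ : ℝ) ≤ L} : ℝ) ≤
      n.factorial * Real.exp (t * L - t * (n * (n - 1)) / 4 + t ^ 2 * n ^ 3 / 2) := by
  have h1 : (#{σ : Perm (Fin n) | (invCount σ : ℝ) ≤ L} : ℝ) * Real.exp (-(t * L)) ≤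
      ∑ σ : Perm (Fin n), Real.exp (-t) ^ invCount σ := by
    rw [← nsmul_eq_mul, ← sum_const]
    refine (sum_le_sum fun σ hσ => ?_).trans
      (sum_le_sum_of_subset_of_nonneg (filter_subset _ _) fun _ _ _ => by positivity)
    rw [mem_filter] at hσ
    rw [← Real.exp_nat_mul, Real.exp_le_exp]
    nlinarith [hσ.2]
  have h2 : ∏ i : Fin n, ∑ j ∈ range (i + 1), Real.exp (-t) ^ j ≤
      n.factorial * Real.exp (-(t * (n * (n - 1)) / 4) + t ^ 2 * n ^ 3 / 2) := by
    refine (prod_le_prod (fun _ _ => by positivity)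
      fun i _ => sum_exp_neg_le i.2 ht).trans_eq ?_
    rw [prod_mul_distrib, ← Real.exp_sum]
    congr 1
    · rw [Fin.prod_univ_eq_prod_range (fun k => (k + 1 : ℝ)) n, ← prod_range_add_one_eq_factorial]
      push_cast
      rfl
    · rw [Fin.sum_univ_eq_sum_range (fun k => -(t * (k : ℝ) / 2) + t ^ 2 * (n : ℝ) ^ 2 / 2) n]
      have h3 : (∑ j ∈ range n, (j : ℝ)) * 2 = n * (n - 1) := by
        rcases n with _ | n
        · simp
        · have := Finset.sum_range_id_mul_two (n + 1)
          rw [Nat.add_sub_cancel] at this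
          have h4 := congrArg (Nat.cast (R := ℝ)) this
          push_cast at h4
          push_cast
          rw [h4]; ring
      rw [sum_add_distrib, sum_neg_distrib, ← sum_div, ← mul_sum]
      simp only [sum_const, card_range, nsmul_eq_mul]
      congr 1
      rw [← h3]
      ring
  have h3 := h1.trans ((sum_pow_invCount_le (Real.exp_pos _).le).trans h2)
  rw [Real.exp_neg, ← div_eq_mul_inv, div_le_iff₀ (Real.exp_pos _), mul_assoc, ← Real.exp_add] at h3
  refine h3.trans_eq ?_
  congr 2
  ring

/-! ### Combining the two tails -/

namespace CoxeterSystem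

variable {m : ℕ} {W : Type*} [Group W] (cs : CoxeterSystem (CoxeterMatrix.A m) W)

theorem IsProper.invCount_le {cs : CoxeterSystem (CoxeterMatrix.A m) W} {w : W}
    (hw : cs.IsProper w) :
    invCount (cs.toPerm w⁻¹) ≤ m + (descentCount (cs.toPerm w⁻¹) + 1).choose 2 := by
  rw [← cs.length_eq_invCount, cs.length_inv, descentCount, ← cs.leftDescentCount_eq]
  refine hw.trans ?_
  rw [Fintype.card_fin]
  exact Nat.add_le_add_left (cs.maxLongestLength_le _) m

theorem ncard_isProper_le :
    {w : W | cs.IsProper w}.ncard ≤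
      #{σ : Perm (Fin (m + 1)) | invCount σ ≤ m + (descentCount σ + 1).choose 2} := by
  rw [← Set.ncard_coe_finset]
  refine Set.ncard_le_ncard_of_injOn (fun w => cs.toPerm w⁻¹) ?_ ?_ (Finset.finite_toSet _)
  · intro w hw
    simpa using IsProper.invCount_le hw
  · intro w _ w' _ h
    exact inv_injective (cs.toPerm_injective h)

end CoxeterSystem

/-- If `d ≤ 2m/3`, then `m + d(d+1)/2 ≤ 2m²/9 + 4m/3`. -/
theorem card_invCount_le_descent_bound {m : ℕ} :
    (#{σ : Perm (Fin (m + 1)) | invCount σ ≤ m + (descentCount σ + 1).choose 2} : ℝ) ≤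
      #{σ : Perm (Fin (m + 1)) | 2 * m ≤ 3 * descentCount σ} +
      #{σ : Perm (Fin (m + 1)) |
        (invCount σ : ℝ) ≤ 2 * (m + 1) ^ 2 / 9 + 4 * (m + 1) / 3} := by
  have hsub : ({σ | invCount σ ≤ m + (descentCount σ + 1).choose 2} :
      Finset (Perm (Fin (m + 1)))) ⊆
      (univ.filter fun σ => 2 * m ≤ 3 * descentCount σ) ∪
        univ.filter fun σ => (invCount σ : ℝ) ≤ 2 * (m + 1) ^ 2 / 9 + 4 * (m + 1) / 3 := by
    intro σ hσ
    simp only [mem_union, mem_filter_univ] at hσ ⊢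
    refine or_iff_not_imp_left.2 fun hd => ?_
    have hd' : (3 * descentCount σ : ℝ) ≤ 2 * m := by
      have : 3 * descentCount σ ≤ 2 * m := by omega
      exact_mod_cast this
    have h : (invCount σ : ℝ) ≤ m + ((descentCount σ + 1).choose 2 : ℕ) := by exact_mod_cast hσ
    rw [Nat.cast_choose_two] at h
    push_cast at h
    have h0 : (0 : ℝ) ≤ descentCount σ := Nat.cast_nonneg _
    nlinarith
  exact_mod_cast (card_le_card hsub).trans (card_union_le _ _)

theorem descent_tail_exponent_le (m : ℕ) :
    (m + 1 : ℝ) / 2 * Real.log (3 / 2) - m / 3 * Real.log 2 ≤ 1 - (m + 1) / 2592 := by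
  have h1 : Real.log (3 / 2) ≤ 2 / 3 * Real.log 2 - 1 / 30 := by
    -- The exponent is negative to leading order because `(3/2)³ < 2²`.
    have h : Real.log (27 / 32) ≤ 27 / 32 - 1 := Real.log_le_sub_one_of_pos (by norm_num)
    have h' : Real.log (27 / 32) = 3 * Real.log (3 / 2) - 2 * Real.log 2 := by
      rw [show (27 / 32 : ℝ) = (3 / 2) ^ 3 / 2 ^ 2 by norm_num,
        Real.log_div (by norm_num) (by norm_num), Real.log_pow, Real.log_pow]
      norm_num
    linarith
  have h2 : Real.log 2 ≤ 1 := Real.log_two_lt_d9.le.trans (by norm_num)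
  have hm : (0 : ℝ) ≤ m := Nat.cast_nonneg m
  nlinarith [mul_le_mul_of_nonneg_left h1 (by linarith : (0 : ℝ) ≤ (m + 1) / 2)]

theorem card_invCount_le_quadratic_le (m : ℕ) :
    (#{σ : Perm (Fin (m + 1)) |
        (invCount σ : ℝ) ≤ 2 * (m + 1) ^ 2 / 9 + 4 * (m + 1) / 3} : ℝ) ≤
      (m + 1).factorial * Real.exp (1 - (m + 1) / 2592) := by
  have hm : (0 : ℝ) < m + 1 := by positivity
  -- With `1/4 - 2/9 = 1/36`, the leading exponent `-t n²/36 + t² n³/2` is minimal at this `t`, with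
  -- value `-n/2592`.
  refine (card_invCount_le_le (t := 1 / (36 * (m + 1))) (by positivity)).trans ?_
  refine mul_le_mul_of_nonneg_left (Real.exp_le_exp.2 ?_) (by positivity)
  push_cast
  have : 1 / (36 * (m + 1 : ℝ)) * (2 * (m + 1) ^ 2 / 9 + 4 * (m + 1) / 3) -
      1 / (36 * (m + 1)) * ((m + 1) * (m + 1 - 1)) / 4 +
      (1 / (36 * (m + 1))) ^ 2 * (m + 1) ^ 3 / 2 = 19 / 432 - (m + 1) / 2592 := by
    field_simp
    ring
  rw [this]
  linarith

/-- Exponentially few elements of the Coxeter group of type `A` are proper. -/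
theorem ncard_isProper_le_exp {m : ℕ} (hm : 15552 ≤ m + 1) {W : Type*} [Group W]
    (cs : CoxeterSystem (CoxeterMatrix.A m) W) :
    ({w : W | cs.IsProper w}.ncard : ℝ) ≤
      (m + 1).factorial * Real.exp (-(1 / 5184 * ((m + 1 : ℕ) : ℝ))) := by
  have hm' : (15552 : ℝ) ≤ m + 1 := by exact_mod_cast hm
  have h1 : ({w : W | cs.IsProper w}.ncard : ℝ) ≤
      #{σ : Perm (Fin (m + 1)) | invCount σ ≤ m + (descentCount σ + 1).choose 2} := by
    exact_mod_cast cs.ncard_isProper_le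
  have h2 := card_descentCount_ge_le m
  have h3 : ((m + 1).factorial : ℝ) *
      Real.exp ((m + 1) / 2 * Real.log (3 / 2) - m / 3 * Real.log 2) ≤
      (m + 1).factorial * Real.exp (1 - (m + 1) / 2592) :=
    mul_le_mul_of_nonneg_left (Real.exp_le_exp.2 (descent_tail_exponent_le m)) (by positivity)
  have h4 := card_invCount_le_quadratic_le m
  have h5 := card_invCount_le_descent_bound (m := m)
  -- The 3 counts two parity classes and the inversion tail. As `3 ≤ e²`, halving the rate requires
  -- `3 ≤ n/5184`, whence the threshold 15552.
  have h6 : 3 * Real.exp (1 - (m + 1) / 2592) ≤ Real.exp (-(1 / 5184 * ((m + 1 : ℕ) : ℝ))) := by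
    have h : (3 : ℝ) ≤ Real.exp 2 := by linarith [Real.add_one_le_exp (2 : ℝ)]
    refine (mul_le_mul_of_nonneg_right h (Real.exp_pos _).le).trans ?_
    rw [← Real.exp_add, Real.exp_le_exp]
    push_cast
    linarith
  calc ({w : W | cs.IsProper w}.ncard : ℝ)
      ≤ (m + 1).factorial * (3 * Real.exp (1 - (m + 1) / 2592)) := by linarith
    _ ≤ _ := mul_le_mul_of_nonneg_left h6 (by positivity)

theorem proposition5p1 :
    ∃ c : ℝ, 0 < c ∧ ∃ N : ℕ, ∀ n : ℕ, N ≤ n →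
      ∀ (W : Type*) [Group W] (cs : CoxeterSystem (CoxeterMatrix.A (n - 1)) W),
        Finite W ∧
          ({w : W | cs.IsProper w}.ncard : ℝ) ≤ (n.factorial : ℝ) * Real.exp (-(c * (n : ℝ))) := by
  refine ⟨1 / 5184, by norm_num, 15552, fun n hn W _ cs => ?_⟩
  obtain ⟨m, rfl⟩ : ∃ m, n = m + 1 := ⟨n - 1, by omega⟩
  exact ⟨cs.finite_and_card_le_of_typeA.1, ncard_isProper_le_exp hn cs⟩
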